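/- **Setting.** Let $\mathcal H=\mathbb R^{n_1}\otimes\cdots\otimes\mathbb R^{n_d}$ carry the Euclidean inner product of the entries, and let $\mathbb T$ be a dimension tree on $\{1,\dots,d\}$: a set of nonempty subsets of $\{1,\dots,d\}$ (nodes), containing $\{1,\dots,d\}$ and every $\{i\}$, any two of which are nested or disjoint. For a node $\alpha$ let $\mathbf U^\alpha$ be the matricisation of a tensor $\mathbf u$ with row index $(\mu_i)_{i\in\alpha}$ and column index $(\mu_i)_{i\notin\alpha}$. Fix a set $S\subseteq\mathbb T$ of nodes at which the rank is prescribed ($S=\mathbb T$ for hierarchical and Tucker tensors, the chain $\{1\},\{1,2\},\dots,\{1,\dots,d\}$ for tensor trains). For $\mathbf r=(r_\alpha)_{\alpha\in S}$ let $$\mathcal M_{\mathbf r}=\{\mathbf u:\operatorname{rank}\mathbf U^\alpha=r_\alpha\ \forall\alpha\in S\},\qquad \mathcal M_{\le\mathbf r}=\{\mathbf u:\operatorname{rank}\mathbf U^\alpha\le r_\alpha\ \forall\alpha\in S\},\qquad \partial\mathcal M_{\mathbf r}=\mathcal M_{\le\mathbf r}\setminus\mathcal M_{\mathbf r}$$ (the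 last being the set of singular points). For a linear map $\mathcal A:\mathcal H\to\mathbb R^m$, let $\delta_{3\mathbf r}(\mathcal A)$ be the smallest $c\ge 0$ such that $(1-c)\|\mathbf v\|^2\le\|\mathcal A\mathbf v\|^2\le(1+c)\|\mathbf v\|^2$ for all $\mathbf v\in\mathcal M_{\le 3\mathbf r}$. Let $\mathcal T_{\mathbf v}$ be the tangent space of $\mathcal M_{\mathbf r}$ at $\mathbf v$ and $P_{\mathcal T_{\mathbf v}}$ the orthogonal projection onto it. A retraction is a map $R$ into $\mathcal M_{\mathbf r}$, defined and twice differentiable on a neighbourhood $\mathcal D$ of the zero section in the tangent bundle $\{(\mathbf v,\boldsymbol\xi):\mathbf v\in\mathcal M_{\mathbf r},\ \boldsymbol\xi\in\mathcal T_{\mathbf v}\}$, such that for each $\mathbf v\in\mathcal M_{\mathbf r}$ one has $R(\mathbf v,\mathbf 0)=\mathbf v$ and $\|\mathbf v+\boldsymbol\xi-R(\mathbf v,\boldsymbol\xi)\|=O(\|\boldsymbol\xi\|^2)$ as $\boldsymbol\xi\to\mathbf 0$ in $\mathcal T_{\mathbf v}$. **Theorem (Local convergence).** Let $\delta<1$.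 There are rates $\rho=\rho(\delta,\varepsilon)\in(0,1)$, $\varepsilon>0$, depending only on $\delta$ and $\varepsilon$, with the following property. For every such format, every rank tuple $\mathbf r$, every retraction $R$ onto $\mathcal M_{\mathbf r}$ and every $\mathbf u\in\mathcal M_{\le\mathbf r}$ there is $\varepsilon_0>0$ such that for all $0<\varepsilon\le\varepsilon_0$, all $m$ and all linear $\mathcal A:\mathcal H\to\mathbb R^m$ with $\delta_{3\mathbf r}(\mathcal A)\le\delta$ the following holds. Put $\mathbf b=\mathcal A\mathbf u$, let $\mathbf u^0\in\mathcal M_{\mathbf r}$ satisfy $$\|\mathbf u-\mathbf u^0\|\le\varepsilon<\operatorname{dist}(\mathbf u^0,\partial\mathcal M_{\mathbf r})$$ (the distance to the empty set being $+\infty$), and let $\mathbf u^n$ be the iterates of the Riemannian gradient iteration $$\mathbf y^{n+1}=\mathbf u^n+\mathcal A^*(\mathbf b-\mathcal A\mathbf u^n),\qquad \mathbf u^{n+1}=R\bigl(\mathbf u^n,\ P_{\mathcal T_{\mathbf u^n}}\mathbf y^{n+1}-\mathbf u^n\bigr).$$ Then all steps are well defined, i.e. $\mathbf u^n\in\mathcal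 M_{\mathbf r}$ and $(\mathbf u^n,P_{\mathcal T_{\mathbf u^n}}\mathbf y^{n+1}-\mathbf u^n)\in\mathcal D$ for all $n$, and the iterates converge linearly to $\mathbf u$: $$\|\mathbf u^{n+1}-\mathbf u\|\le\rho(\delta,\varepsilon)\,\|\mathbf u^n-\mathbf u\|\quad\text{for all }n,\qquad \mathbf u^n\to\mathbf u .$$ -/

import Mathlib

open Filter Topology

namespace HierTensor

/-- The tensor space `ℝ^{n₁} ⊗ ⋯ ⊗ ℝ^{n_d}`, as the space of hyper-matrices
`μ ↦ u(μ₁, …, μ_d)` with the Euclidean norm and inner product. -/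
abbrev TensorSpace {d : ℕ} (n : Fin d → ℕ) : Type :=
  EuclideanSpace ℝ (∀ i : Fin d, Fin (n i))

/-- A dimension (partition) tree on the set of directions, given by its set of nodes: nonempty sets
of directions, containing the root and all leaves, any two of them nested or disjoint.
The sons of a node are the maximal nodes properly inside it; they partition it.  The number of sons
is not restricted, so binary trees and the Tucker tree are included. -/
structure IsDimensionTree {d : ℕ} (𝕋 : Finset (Finset (Fin d))) : Prop where
  nonempty : ∀ α ∈ 𝕋, α.Nonempty
  root_mem : Finset.univ ∈ 𝕋
  leaf_mem : ∀ i : Fin d, {i} ∈ 𝕋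
  nested_or_disjoint : ∀ α ∈ 𝕋, ∀ β ∈ 𝕋, α ⊆ β ∨ β ⊆ α ∨ Disjoint α β

/-- The matricisation `U^α` of a tensor: the indices `μ_i` with `i ∈ α` form the row index, the
other ones form the column index. -/
def matricisation {d : ℕ} {n : Fin d → ℕ} (u : TensorSpace n) (α : Finset (Fin d)) :
    Matrix (∀ i : {i // i ∈ α}, Fin (n i)) (∀ i : {i // ¬ i ∈ α}, Fin (n i)) ℝ :=
  Matrix.of fun I J => u fun i => if h : i ∈ α then I ⟨i, h⟩ else J ⟨i, h⟩

/-- The tensors whose multi-linear rank is exactly `r`; the rank is prescribed at the nodes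
in `S`. -/
def rankEq {d : ℕ} (n : Fin d → ℕ) (S : Finset (Finset (Fin d))) (r : Finset (Fin d) → ℕ) :
    Set (TensorSpace n) :=
  {u | ∀ α ∈ S, (matricisation u α).rank = r α}

/-- The tensors whose multi-linear rank is at most `r`. -/
def rankLE {d : ℕ} (n : Fin d → ℕ) (S : Finset (Finset (Fin d))) (r : Finset (Fin d) → ℕ) :
    Set (TensorSpace n) :=
  {u | ∀ α ∈ S, (matricisation u α).rank ≤ r α}

/-- The singular points: tensors of rank at most `r` one of whose ranks is not maximal. -/
def singularPoints {d : ℕ} (n : Fin d → ℕ) (S : Finset (Finset (Fin d)))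
    (r : Finset (Fin d) → ℕ) : Set (TensorSpace n) :=
  rankLE n S r \ rankEq n S r

/-- The tensor restricted isometry constant `δ_r` of a measurement map: the smallest `c ≥ 0` with
`(1 - c) ‖v‖² ≤ ‖A v‖² ≤ (1 + c) ‖v‖²` for all tensors `v` of rank at most `r`. -/
noncomputable def tric {d : ℕ} {n : Fin d → ℕ} {m : ℕ} (S : Finset (Finset (Fin d)))
    (r : Finset (Fin d) → ℕ) (A : TensorSpace n →ₗ[ℝ] EuclideanSpace ℝ (Fin m)) : ℝ :=
  sInf {c : ℝ | 0 ≤ c ∧ ∀ v ∈ rankLE n S r,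
    (1 - c) * ‖v‖ ^ 2 ≤ ‖A v‖ ^ 2 ∧ ‖A v‖ ^ 2 ≤ (1 + c) * ‖v‖ ^ 2}

section Manifold

variable {H : Type*} [NormedAddCommGroup H] [InnerProductSpace ℝ H]

/-- The tangent space at `v` of a submanifold `M` of `H`: the velocities `γ'(0)` of the curves `γ`
in `M` through `γ(0) = v`.  (For a submanifold these velocities already form a linear subspace.) -/
def tangentSpaceAt (M : Set H) (v : H) : Submodule ℝ H :=
  Submodule.span ℝ {ξ | ∃ γ : ℝ → H,
    γ 0 = v ∧ (∀ᶠ t in 𝓝 (0 : ℝ), γ t ∈ M) ∧ HasDerivAt γ ξ 0}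

/-- The tangent bundle of `M`, as a set of pairs `(v, ξ)` with `ξ` tangent at `v`. -/
def tangentPairs (M : Set H) : Set (H × H) :=
  {p | p.1 ∈ M ∧ p.2 ∈ tangentSpaceAt M p.1}

/-- `R` is twice differentiable on the set `D`. -/
def TwiceDifferentiableOn (R : H × H → H) (D : Set (H × H)) : Prop :=
  ∃ R' : H × H → (H × H →L[ℝ] H),
    (∀ p ∈ D, HasFDerivWithinAt R (R' p) D p) ∧ DifferentiableOn ℝ R' D

/-- `R` is a retraction onto the submanifold `M`, with domain `D`, a neighbourhood of the zero
section in the tangent bundle of `M`: it is a twice differentiable map from `D` to `M` with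
`R(v, 0) = v` and `‖v + ξ - R(v, ξ)‖ = O(‖ξ‖²)` for small tangent vectors `ξ` at `v`. -/
structure IsRetraction (M : Set H) (D : Set (H × H)) (R : H × H → H) : Prop where
  subset : D ⊆ tangentPairs M
  nhds_zero : ∀ v ∈ M, D ∈ 𝓝[tangentPairs M] (v, 0)
  mapsTo : ∀ p ∈ D, R p ∈ M
  twiceDifferentiable : TwiceDifferentiableOn R D
  map_zero : ∀ v ∈ M, R (v, 0) = v
  isBigO : ∀ v ∈ M,
    (fun ξ : H => v + ξ - R (v, ξ)) =O[𝓝[(tangentSpaceAt M v : Set H)] 0] fun ξ => ‖ξ‖ ^ 2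

end Manifold

/-- The tangent vector `ξ = P_{T_v} y - v` of a step of the Riemannian gradient iteration at `v`,
where `y = v + A^* (b - A v)` is the gradient step and `P_{T_v}` is the orthogonal projection
onto the tangent space at `v`. -/
noncomputable def rgiDirection {d : ℕ} {n : Fin d → ℕ} {m : ℕ} (M : Set (TensorSpace n))
    (A : TensorSpace n →ₗ[ℝ] EuclideanSpace ℝ (Fin m)) (b : EuclideanSpace ℝ (Fin m))
    (v : TensorSpace n) : TensorSpace n :=
  (tangentSpaceAt M v).starProjection (v + LinearMap.adjoint A (b - A v)) - v

end HierTensor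

/-! Write `w = u - v` for the error at an iterate `v`, `P` for the projection onto the tangent space
at `v`, `p = P w` and `ξ = P A* A w` for the step direction. The new error splits into three terms:
the retraction error `R (v, ξ) - v - ξ`, the tangential defect `p - P A* A p`, and `P A* A (w - p) -
(w - p)`.

The middle term is at most `δ‖w‖`: tangent vectors have rank at most `2r` at each prescribed node
(`rank_tangent_le`), so `A` is nearly isometric on the tangent space and `P A* A` is close to the
identity there (`norm_sub_proj_adjoint_le`). The other two are `o(‖w‖)`, uniformly in `v` and `A`.
For the retraction error this is continuity of the derivative of `R` at `(u, 0)`. For the last term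
it is the curvature estimate `‖w - P w‖ ≤ C‖w‖²` (`exists_norm_sub_tangentProj_le`), together with a
bound on `A` over the whole space that depends only on the number of entries. Hence any rate above
`δ` is reached close to `u`.

The curvature estimate needs no parametrisation of the manifold. At one node, the normal component
of `u` at `v` is `(1 - P_col) U (1 - P_row)`. Inserting `U = U G U`, with `G` a generalized inverse,
makes it quadratic in `u - v` with a constant depending on `u` alone (`exists_normalProj_le`).
Projections belonging to nested or disjoint nodes commute, so `w` can be peeled along the nodes into
a tangent vector and a remainder bounded by the sum of the single-node normal components
(`exists_tangent_approx`).

If `u` itself is singular, the distance hypothesis is contradictory. -/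

namespace HierTensor

/-! ### Operators acting on a block of coordinates, and their commuting projections. -/

section Operators

variable {d : ℕ} {n : Fin d → ℕ}

/-- The elementary operator moving the block `κ'` of the coordinates in `β` to the block `κ`. -/
noncomputable def blockUnit (β : Finset (Fin d)) (κ κ' : ∀ i, Fin (n i)) :
    TensorSpace n →L[ℝ] TensorSpace n :=
  LinearMap.toContinuousLinearMap
    { toFun := fun x => WithLp.toLp 2 fun μ =>
        if ∀ i ∈ β, μ i = κ i then x (β.piecewise κ' μ) else 0
      map_add' := by
        intro x y; ext μ; simp only [PiLp.add_apply]; split_ifs <;> simp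
      map_smul' := by
        intro c x; ext μ; simp only [PiLp.smul_apply, RingHom.id_apply]; split_ifs <;> simp }

theorem blockUnit_apply (β : Finset (Fin d)) (κ κ' : ∀ i, Fin (n i)) (x : TensorSpace n)
    (μ : ∀ i, Fin (n i)) :
    blockUnit β κ κ' x μ = if ∀ i ∈ β, μ i = κ i then x (β.piecewise κ' μ) else 0 := rfl

theorem blockUnit_adjoint (β : Finset (Fin d)) (κ κ' : ∀ i, Fin (n i)) :
    star (blockUnit β κ κ') = blockUnit β κ' κ := by
  rw [ContinuousLinearMap.star_eq_adjoint, eq_comm, ContinuousLinearMap.eq_adjoint_iff]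
  intro x y
  simp only [PiLp.inner_apply, blockUnit_apply, RCLike.inner_apply, conj_trivial]
  simp only [mul_ite, ite_mul, mul_zero, zero_mul]
  rw [← Finset.sum_filter, ← Finset.sum_filter]
  refine Finset.sum_nbij' (fun μ => β.piecewise κ μ) (fun μ => β.piecewise κ' μ) ?_ ?_ ?_ ?_ ?_
  · intro μ _
    simp +contextual
  · intro μ _
    simp +contextual
  · intro μ hμ
    simp only [Finset.mem_filter, Finset.mem_univ, true_and] at hμ
    funext i
    by_cases hi : i ∈ β <;> simp [hi, hμ]
  · intro μ hμ
    simp only [Finset.mem_filter, Finset.mem_univ, true_and] at hμ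
    funext i
    by_cases hi : i ∈ β <;> simp [hi, hμ]
  · intro μ hμ
    simp only [Finset.mem_filter, Finset.mem_univ, true_and] at hμ
    have : β.piecewise κ' (β.piecewise κ μ) = μ := by
      funext i
      by_cases hi : i ∈ β <;> simp [hi, hμ]
    rw [this]

theorem blockUnit_comm {β γ : Finset (Fin d)} (h : Disjoint β γ) (κ κ' l l' : ∀ i, Fin (n i)) :
    Commute (blockUnit β κ κ') (blockUnit γ l l') := by
  have hβ : ∀ i ∈ β, i ∉ γ := fun i hi hi' => Finset.disjoint_left.1 h hi hi'
  have hγ : ∀ i ∈ γ, i ∉ β := fun i hi hi' => Finset.disjoint_left.1 h hi' hi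
  ext x μ
  simp only [mul_apply_eq_comp, blockUnit_apply]
  have e1 : (∀ i ∈ γ, β.piecewise κ' μ i = l i) ↔ ∀ i ∈ γ, μ i = l i :=
    forall₂_congr fun i hi => by simp [hγ i hi]
  have e2 : (∀ i ∈ β, γ.piecewise l' μ i = κ i) ↔ ∀ i ∈ β, μ i = κ i :=
    forall₂_congr fun i hi => by simp [hβ i hi]
  have e3 : γ.piecewise l' (β.piecewise κ' μ) = β.piecewise κ' (γ.piecewise l' μ) := by
    funext i
    by_cases hi : i ∈ β
    · simp [hi, hβ i hi]
    · by_cases hi' : i ∈ γ <;> simp [hi, hi']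
  simp only [e1, e2, e3]
  split_ifs <;> rfl

/-- The algebra of the operators that act on the coordinates in `α` only. -/
noncomputable def localOperators (n : Fin d → ℕ) (α : Finset (Fin d)) :
    Subalgebra ℝ (TensorSpace n →L[ℝ] TensorSpace n) :=
  Subalgebra.centralizer ℝ {T | ∃ β κ κ', Disjoint β α ∧ T = blockUnit β κ κ'}

theorem mem_localOperators {α : Finset (Fin d)} {T : TensorSpace n →L[ℝ] TensorSpace n} :
    T ∈ localOperators n α ↔ ∀ β κ κ', Disjoint β α → Commute (blockUnit β κ κ') T := by
  rw [localOperators, Subalgebra.mem_centralizer_iff]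
  constructor
  · intro h β κ κ' hβ
    exact h _ ⟨β, κ, κ', hβ, rfl⟩
  · rintro h _ ⟨β, κ, κ', hβ, rfl⟩
    exact h β κ κ' hβ

theorem localOperators_mono {α β : Finset (Fin d)} (h : α ⊆ β) :
    localOperators n α ≤ localOperators n β := fun _ hT =>
  mem_localOperators.2 fun γ κ κ' hγ => mem_localOperators.1 hT γ κ κ' (hγ.mono_right h)

theorem star_mem_localOperators {α : Finset (Fin d)} {T : TensorSpace n →L[ℝ] TensorSpace n}
    (hT : T ∈ localOperators n α) : star T ∈ localOperators n α := by
  rw [mem_localOperators] at hT ⊢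
  intro β κ κ' hβ
  have := (hT β κ' κ hβ).star_star
  rwa [blockUnit_adjoint] at this

theorem blockUnit_mem_localOperators {α β : Finset (Fin d)} (h : β ⊆ α) (κ κ' : ∀ i, Fin (n i)) :
    blockUnit β κ κ' ∈ localOperators n α :=
  mem_localOperators.2 fun _ _ _ hγ => blockUnit_comm (hγ.mono_right h) _ _ _ _

/-- The tensors obtained from `v` by operators acting on the coordinates in `α` only. -/
noncomputable def localOrbit (α : Finset (Fin d)) (v : TensorSpace n) :
    Submodule ℝ (TensorSpace n) :=
  (Subalgebra.toSubmodule (localOperators n α)).map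
    (ContinuousLinearMap.apply ℝ (TensorSpace n) v).toLinearMap

theorem mem_localOrbit {α : Finset (Fin d)} {v x : TensorSpace n} :
    x ∈ localOrbit α v ↔ ∃ T ∈ localOperators n α, T v = x := by
  simp [localOrbit]

theorem self_mem_localOrbit (α : Finset (Fin d)) (v : TensorSpace n) : v ∈ localOrbit α v :=
  mem_localOrbit.2 ⟨1, one_mem _, rfl⟩

theorem localOrbit_mono {α β : Finset (Fin d)} (h : α ⊆ β) (v : TensorSpace n) :
    localOrbit α v ≤ localOrbit β v := by
  intro x hx
  obtain ⟨T, hT, rfl⟩ := mem_localOrbit.1 hx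
  exact mem_localOrbit.2 ⟨T, localOperators_mono h hT, rfl⟩

theorem apply_mem_localOrbit {α : Finset (Fin d)} {v x : TensorSpace n}
    {T : TensorSpace n →L[ℝ] TensorSpace n} (hT : T ∈ localOperators n α)
    (hx : x ∈ localOrbit α v) : T x ∈ localOrbit α v := by
  obtain ⟨T', hT', rfl⟩ := mem_localOrbit.1 hx
  exact mem_localOrbit.2 ⟨T * T', mul_mem hT hT', rfl⟩

/-- The orthogonal projection onto `localOrbit α v`. -/
noncomputable abbrev orbitProj (α : Finset (Fin d)) (v : TensorSpace n) :
    TensorSpace n →L[ℝ] TensorSpace n :=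
  (localOrbit α v).starProjection

/-- The orbit is invariant under an algebra closed under adjoints, so its orthogonal complement is
invariant too. -/
theorem orbitProj_commute {α : Finset (Fin d)} (v : TensorSpace n)
    {T : TensorSpace n →L[ℝ] TensorSpace n} (hT : T ∈ localOperators n α) :
    Commute T (orbitProj α v) := by
  ext1 x
  simp only [mul_apply_eq_comp]
  symm
  apply Submodule.eq_starProjection_of_mem_of_inner_eq_zero
  · exact apply_mem_localOrbit hT (Submodule.starProjection_apply_mem _ _)
  · intro w hw
    rw [← map_sub, ← ContinuousLinearMap.adjoint_inner_right]
    exact Submodule.starProjection_inner_eq_zero x _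
      (apply_mem_localOrbit (star_mem_localOperators hT) hw)

/-- In matrix terms, `orbitProj α v` multiplies `U^α` from the right by the projection onto the row
space of `V^α`; it therefore acts on the complementary coordinates. Likewise `orbitProj αᶜ v` is
left multiplication by the projection onto the column space. -/
theorem orbitProj_mem_localOperators (α : Finset (Fin d)) (v : TensorSpace n) :
    orbitProj α v ∈ localOperators n αᶜ :=
  mem_localOperators.2 fun _ κ κ' hβ => orbitProj_commute v
    (blockUnit_mem_localOperators (Finset.subset_iff.2 fun _ hi => by_contra fun h =>
      Finset.disjoint_left.1 hβ hi (Finset.mem_compl.2 h)) κ κ')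

theorem orbitProj_commute_of_compl_subset {α β : Finset (Fin d)} (h : αᶜ ⊆ β)
    (v : TensorSpace n) : Commute (orbitProj α v) (orbitProj β v) :=
  orbitProj_commute v (localOperators_mono h (orbitProj_mem_localOperators α v))

theorem orbitProj_commute_of_subset {α β : Finset (Fin d)} (h : α ⊆ β) (v : TensorSpace n) :
    Commute (orbitProj α v) (orbitProj β v) := by
  have hle := localOrbit_mono h v
  have h1 : orbitProj β v * orbitProj α v = orbitProj α v := by
    ext1 x
    exact Submodule.starProjection_eq_self_iff.2 (hle (Submodule.starProjection_apply_mem _ _))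
  have h2 := congrArg star h1
  rw [star_mul, (isSelfAdjoint_starProjection _).star_eq,
    (isSelfAdjoint_starProjection _).star_eq] at h2
  exact h2.trans h1.symm

/-- The orthogonal projection onto the normal space at `v` of the tensors of fixed rank at `α`. -/
noncomputable def normalProj (α : Finset (Fin d)) (v : TensorSpace n) :
    TensorSpace n →L[ℝ] TensorSpace n :=
  (1 - orbitProj αᶜ v) * (1 - orbitProj α v)

end Operators

/-! ### Local operators as left and right matrix multiplications. -/

section Matricisation

variable {d : ℕ} {n : Fin d → ℕ}

/-- The tensor with a given matricisation. -/
noncomputable def ofMatricisation (α : Finset (Fin d))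
    (M : Matrix (∀ i : {i // i ∈ α}, Fin (n i)) (∀ i : {i // ¬ i ∈ α}, Fin (n i)) ℝ) :
    TensorSpace n :=
  WithLp.toLp 2 fun μ => M (fun i => μ i) (fun i => μ i)

theorem matricisation_ofMatricisation (α : Finset (Fin d))
    (M : Matrix (∀ i : {i // i ∈ α}, Fin (n i)) (∀ i : {i // ¬ i ∈ α}, Fin (n i)) ℝ) :
    matricisation (ofMatricisation α M) α = M := by
  ext I J
  simp only [matricisation, ofMatricisation, Matrix.of_apply]
  congr 1
  · funext i; simp [i.2]
  · funext i; simp [i.2]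

theorem ofMatricisation_matricisation (α : Finset (Fin d)) (u : TensorSpace n) :
    ofMatricisation α (matricisation u α) = u := by
  ext μ
  simp [matricisation, ofMatricisation]

theorem matricisation_injective (α : Finset (Fin d)) :
    Function.Injective fun u : TensorSpace n => matricisation u α :=
  Function.LeftInverse.injective (ofMatricisation_matricisation α)

theorem matricisation_add (u v : TensorSpace n) (α : Finset (Fin d)) :
    matricisation (u + v) α = matricisation u α + matricisation v α := rfl

theorem matricisation_smul (c : ℝ) (u : TensorSpace n) (α : Finset (Fin d)) :
    matricisation (c • u) α = c • matricisation u α := rfl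

theorem matricisation_zero (α : Finset (Fin d)) :
    matricisation (0 : TensorSpace n) α = 0 := rfl

theorem continuous_matricisation (α : Finset (Fin d)) :
    Continuous fun u : TensorSpace n => matricisation u α := by
  refine continuous_matrix fun I J => ?_
  exact (PiLp.continuous_apply 2 _ _)

/-- Two index blocks, for the coordinates in `α` and the other ones, put together. -/
def joinIndex (α : Finset (Fin d)) (I : ∀ i : {i // i ∈ α}, Fin (n i))
    (J : ∀ i : {i // ¬ i ∈ α}, Fin (n i)) : ∀ i, Fin (n i) :=
  fun i => if h : i ∈ α then I ⟨i, h⟩ else J ⟨i, h⟩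

theorem matricisation_apply (u : TensorSpace n) (α : Finset (Fin d)) (I J) :
    matricisation u α I J = u (joinIndex α I J) := rfl

/-- Commuting with the matrix units on `αᶜ` forces the form `M ⊗ 1`: an entry vanishes unless the
outer indices agree, and then they may be replaced by those of a reference index `κ`. -/
theorem apply_single_of_mem {α : Finset (Fin d)} {T : TensorSpace n →L[ℝ] TensorSpace n}
    (hT : T ∈ localOperators n α) (ν μ κ : ∀ i, Fin (n i)) :
    T (EuclideanSpace.single ν 1) μ = if ∀ i ∈ αᶜ, μ i = ν i then
      T (EuclideanSpace.single (αᶜ.piecewise κ ν) 1) (αᶜ.piecewise κ μ) else 0 := by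
  have hc := mem_localOperators.1 hT αᶜ ν κ disjoint_compl_left
  have h1 : blockUnit αᶜ ν κ (EuclideanSpace.single (αᶜ.piecewise κ ν) 1) =
      EuclideanSpace.single ν (1 : ℝ) := by
    ext l
    rw [blockUnit_apply]
    simp only [PiLp.single_apply]
    by_cases hl : l = ν
    · simp [hl]
    · rw [if_neg hl]
      split_ifs with h2 h3
      · exfalso
        apply hl
        funext i
        by_cases hi : i ∈ αᶜ
        · exact h2 i hi
        · have := congrFun h3 i
          simpa only [Finset.piecewise_eq_of_notMem _ _ _ hi] using this
      · rfl
      · rfl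
  have h2 := DFunLike.congr_fun hc (EuclideanSpace.single (αᶜ.piecewise κ ν) (1 : ℝ))
  simp only [mul_apply_eq_comp, h1] at h2
  rw [← h2, blockUnit_apply]

theorem apply_eq_sum (T : TensorSpace n →L[ℝ] TensorSpace n) (x : TensorSpace n)
    (μ : ∀ i, Fin (n i)) : T x μ = ∑ ν, x ν * T (EuclideanSpace.single ν 1) μ := by
  conv_lhs => rw [← (EuclideanSpace.basisFun (∀ i, Fin (n i)) ℝ).sum_repr x]
  simp [map_sum]

/-- Sums over all indices as double sums over index blocks. -/
theorem sum_joinIndex (α : Finset (Fin d)) (f : (∀ i, Fin (n i)) → ℝ) :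
    ∑ ν, f ν = ∑ I, ∑ J, f (joinIndex α I J) := by
  rw [← Fintype.sum_prod_type']
  exact (Equiv.sum_comp (Equiv.piEquivPiSubtypeProd (fun i => i ∈ α) fun i => Fin (n i)).symm
    f).symm

theorem matricisation_local_left {α : Finset (Fin d)} {T : TensorSpace n →L[ℝ] TensorSpace n}
    (hT : T ∈ localOperators n α) :
    ∃ M : Matrix (∀ i : {i // i ∈ α}, Fin (n i)) (∀ i : {i // i ∈ α}, Fin (n i)) ℝ,
      ∀ x, matricisation (T x) α = M * matricisation x α := by
  classical
  rcases isEmpty_or_nonempty (∀ i, Fin (n i)) with he | ⟨⟨κ⟩⟩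
  · refine ⟨0, fun x => ?_⟩
    ext I J
    exact he.elim (joinIndex α I J)
  refine ⟨Matrix.of fun I I' => T (EuclideanSpace.single (joinIndex α I' fun i => κ i) 1)
    (joinIndex α I fun i => κ i), fun x => ?_⟩
  have hp : ∀ I J, αᶜ.piecewise κ (joinIndex α I J) = joinIndex α I fun i => κ i := by
    intro I J; funext i
    by_cases hi : i ∈ α <;> simp [joinIndex, hi]
  have hj : ∀ I I' J J', (∀ i ∈ αᶜ, joinIndex (n := n) α I J i = joinIndex α I' J' i) ↔ J = J' := by
    intro I I' J J'
    constructor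
    · intro h; funext i
      have := h i (by simpa using i.2)
      simpa [joinIndex, i.2] using this
    · rintro rfl i hi
      simp only [Finset.mem_compl] at hi
      simp [joinIndex, hi]
  ext I J
  rw [matricisation_apply, apply_eq_sum, sum_joinIndex α, Matrix.mul_apply]
  refine Finset.sum_congr rfl fun I' _ => ?_
  simp only [apply_single_of_mem hT (joinIndex α I' _) (joinIndex α I J) κ, hp, hj, mul_ite,
    mul_zero, Matrix.of_apply, matricisation_apply]
  rw [Finset.sum_ite_eq]
  simp [mul_comm]

theorem matricisation_local_right {α : Finset (Fin d)} {T : TensorSpace n →L[ℝ] TensorSpace n}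
    (hT : T ∈ localOperators n αᶜ) :
    ∃ M : Matrix (∀ i : {i // ¬ i ∈ α}, Fin (n i)) (∀ i : {i // ¬ i ∈ α}, Fin (n i)) ℝ,
      ∀ x, matricisation (T x) α = matricisation x α * M := by
  classical
  rcases isEmpty_or_nonempty (∀ i, Fin (n i)) with he | ⟨⟨κ⟩⟩
  · refine ⟨0, fun x => ?_⟩
    ext I J
    exact he.elim (joinIndex α I J)
  refine ⟨Matrix.of fun J' J => T (EuclideanSpace.single (joinIndex α (fun i => κ i) J') 1)
    (joinIndex α (fun i => κ i) J), fun x => ?_⟩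
  have hp : ∀ I J, αᶜᶜ.piecewise κ (joinIndex α I J) = joinIndex α (fun i => κ i) J := by
    intro I J; funext i
    by_cases hi : i ∈ α <;> simp [joinIndex, hi]
  have hj : ∀ I I' J J', (∀ i ∈ αᶜᶜ, joinIndex (n := n) α I J i = joinIndex α I' J' i) ↔ I = I' := by
    intro I I' J J'
    constructor
    · intro h; funext i
      have := h i (by simp [i.2])
      simpa [joinIndex, i.2] using this
    · rintro rfl i hi
      rw [compl_compl] at hi
      simp [joinIndex, hi]
  ext I J
  rw [matricisation_apply, apply_eq_sum, sum_joinIndex α, Matrix.mul_apply, Finset.sum_comm]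
  refine Finset.sum_congr rfl fun J' _ => ?_
  simp only [apply_single_of_mem hT (joinIndex α _ J') (joinIndex α I J) κ, hp, hj,
    mul_ite, mul_zero, Matrix.of_apply, matricisation_apply]
  rw [Finset.sum_ite_eq]
  simp

end Matricisation

/-! ### Rank semicontinuity and velocities of matrix curves of bounded rank. -/

section Matrices

variable {m n k l : Type*} [Fintype m] [Fintype n]

theorem exists_generalized_inverse (V : Matrix m n ℝ) : ∃ G : Matrix n m ℝ, V * G * V = V := by
  classical
  let f := Matrix.toLin' V
  obtain ⟨s, hs⟩ := f.rangeRestrict.exists_rightInverse_of_surjective f.range_rangeRestrict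
  obtain ⟨g, hg⟩ := LinearMap.exists_extend s
  refine ⟨LinearMap.toMatrix' g, ?_⟩
  apply Matrix.toLin'.injective
  rw [Matrix.toLin'_mul, Matrix.toLin'_mul, Matrix.toLin'_toMatrix']
  refine LinearMap.ext fun x => ?_
  have h1 : g (f x) = s (f.rangeRestrict x) := DFunLike.congr_fun hg (f.rangeRestrict x)
  have h2 := congrArg Subtype.val (DFunLike.congr_fun hs (f.rangeRestrict x))
  change f (g (f x)) = f x
  rw [h1]
  exact h2

/-- The identity `V (1 + G (W - V)) = V G W` exhibits `V`, up to an invertible factor, as a multiple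
of `W`. -/
theorem rank_le_of_isUnit_det [DecidableEq n] {V W : Matrix m n ℝ} {G : Matrix n m ℝ}
    (hG : V * G * V = V) (h : IsUnit (1 + G * (W - V)).det) : V.rank ≤ W.rank := by
  have e : V * (1 + G * (W - V)) = V * G * W := by
    rw [Matrix.mul_add, Matrix.mul_one, ← Matrix.mul_assoc, Matrix.mul_sub, hG]
    abel
  rw [← Matrix.rank_mul_eq_left_of_isUnit_det _ V h, e]
  exact Matrix.rank_mul_le_right _ _

theorem eventually_rank_le (V : Matrix m n ℝ) : ∀ᶠ W in 𝓝 V, V.rank ≤ W.rank := by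
  classical
  obtain ⟨G, hG⟩ := exists_generalized_inverse V
  have hc : Continuous fun W : Matrix m n ℝ => (1 + G * (W - V)).det := by fun_prop
  have h0 : (1 + G * (V - V)).det ≠ 0 := by simp
  filter_upwards [hc.continuousAt.eventually_ne h0] with W hW
  exact rank_le_of_isUnit_det hG (isUnit_iff_ne_zero.2 hW)

omit [Fintype m] in
theorem rank_add_le (A B : Matrix m n ℝ) : (A + B).rank ≤ A.rank + B.rank := by
  rw [Matrix.rank, Matrix.mulVecLin_add]
  exact (Submodule.finrank_mono (LinearMap.range_add_le _ _)).trans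
    (Submodule.finrank_add_le_finrank_add_finrank _ _)

/-- If left multiplication by `P` does not lower the rank, then `A` and `P * A` have the same
kernel. -/
theorem mul_eq_zero_of_rank_le {A : Matrix m n ℝ} {P : Matrix k m ℝ} {N : Matrix n l ℝ}
    (hr : A.rank ≤ (P * A).rank) (h : P * A * N = 0) : A * N = 0 := by
  have hle : LinearMap.ker A.mulVecLin ≤ LinearMap.ker (P * A).mulVecLin := by
    intro x hx
    simp only [LinearMap.mem_ker, Matrix.mulVecLin_apply] at hx ⊢
    rw [← Matrix.mulVec_mulVec, hx, Matrix.mulVec_zero]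
  have h1 := A.mulVecLin.finrank_range_add_finrank_ker
  have h2 := (P * A).mulVecLin.finrank_range_add_finrank_ker
  have heq := Submodule.eq_of_le_of_finrank_le hle (by
    simp only [Matrix.rank] at hr
    omega)
  ext i j
  have hj : N.col j ∈ LinearMap.ker (P * A).mulVecLin := by
    rw [LinearMap.mem_ker, Matrix.mulVecLin_apply]
    ext i
    exact congrFun (congrFun h i) j
  rw [← heq, LinearMap.mem_ker, Matrix.mulVecLin_apply] at hj
  exact congrFun hj i

omit [Fintype m] in
theorem tendsto_matrix_mul {ι : Type*} {F : Filter ι} {f : ι → Matrix m n ℝ}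
    {g : ι → Matrix n k ℝ} {A : Matrix m n ℝ} {B : Matrix n k ℝ} (hf : Tendsto f F (𝓝 A))
    (hg : Tendsto g F (𝓝 B)) : Tendsto (fun t => f t * g t) F (𝓝 (A * B)) :=
  ((continuous_fst.matrix_mul continuous_snd).tendsto (A, B)).comp (hf.prodMk_nhds hg)

/-- Velocities of curves of matrices of constant rank are tangent to the determinantal variety. -/
theorem mul_velocity_mul_eq_zero {V Ξ : Matrix m n ℝ} {Γ : ℝ → Matrix m n ℝ}
    {M : Matrix k m ℝ} {N : Matrix n l ℝ} (hM : M * V = 0) (hN : V * N = 0)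
    (hr : ∀ᶠ t in 𝓝[≠] (0 : ℝ), (Γ t).rank ≤ V.rank) (hΓ : Tendsto Γ (𝓝[≠] 0) (𝓝 V))
    (hΞ : Tendsto (fun t => t⁻¹ • (Γ t - V)) (𝓝[≠] (0 : ℝ)) (𝓝 Ξ)) : M * Ξ * N = 0 := by
  classical
  obtain ⟨G, hG⟩ := exists_generalized_inverse V
  -- `K t` tends to `1` and `Γ t * adjugate (K t)` has the same kernel as `V` for small `t ≠ 0`, so
  -- it annihilates `N`. The adjugate replaces the inverse because it is continuous everywhere.
  set K : ℝ → Matrix n n ℝ := fun t => 1 + G * (Γ t - V) with hK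
  have hKt : Tendsto K (𝓝[≠] 0) (𝓝 1) := by
    have hc : Continuous fun W : Matrix m n ℝ => 1 + G * (W - V) := by fun_prop
    have := (hc.tendsto V).comp hΓ
    rwa [sub_self, Matrix.mul_zero, add_zero] at this
  have hdet : ∀ᶠ t in 𝓝[≠] (0 : ℝ), (K t).det ≠ 0 := by
    have := (Continuous.matrix_det continuous_id).continuousAt.tendsto.comp hKt
    refine this.eventually_ne ?_
    simp
  have hadj : Tendsto (fun t => (K t).adjugate) (𝓝[≠] 0) (𝓝 1) := by
    have := (Continuous.matrix_adjugate continuous_id).continuousAt.tendsto.comp hKt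
    rwa [id, Matrix.adjugate_one] at this
  have hlim : Tendsto (fun t => M * (t⁻¹ • (Γ t - V)) * (K t).adjugate * N) (𝓝[≠] 0)
      (𝓝 (M * Ξ * (1 : Matrix n n ℝ) * N)) := by
    have h1 : Tendsto (fun t => M * (t⁻¹ • (Γ t - V))) (𝓝[≠] 0) (𝓝 (M * Ξ)) :=
      tendsto_matrix_mul tendsto_const_nhds hΞ
    exact tendsto_matrix_mul (tendsto_matrix_mul h1 hadj) tendsto_const_nhds
  have hzero : ∀ᶠ t in 𝓝[≠] (0 : ℝ), M * (t⁻¹ • (Γ t - V)) * (K t).adjugate * N = 0 := by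
    filter_upwards [hdet, hr] with t ht hrt
    have e : V * K t = V * G * Γ t := by
      rw [hK]
      simp only
      rw [Matrix.mul_add, Matrix.mul_one, ← Matrix.mul_assoc, Matrix.mul_sub, hG]
      abel
    have e2 : V * G * (Γ t * (K t).adjugate) = (K t).det • V := by
      rw [← Matrix.mul_assoc, ← e, Matrix.mul_assoc, Matrix.mul_adjugate, Matrix.mul_smul,
        Matrix.mul_one]
    have h0 : Γ t * (K t).adjugate * N = 0 := by
      apply mul_eq_zero_of_rank_le (P := V * G)
      · rw [e2, Matrix.rank_smul_of_mem_nonZeroDivisors _ (mem_nonZeroDivisors_of_ne_zero ht)]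
        exact (Matrix.rank_mul_le_left _ _).trans hrt
      · rw [e2, Matrix.smul_mul, hN, smul_zero]
    have h1 : M * (Γ t - V) * (K t).adjugate * N = 0 := by
      rw [Matrix.mul_sub, hM, sub_zero, Matrix.mul_assoc, Matrix.mul_assoc, ← Matrix.mul_assoc (Γ t),
        h0, Matrix.mul_zero]
    rw [Matrix.mul_smul, Matrix.smul_mul, Matrix.smul_mul, h1, smul_zero]
  have h := tendsto_nhds_unique (hlim.congr' hzero) tendsto_const_nhds
  rwa [Matrix.mul_one] at h

end Matrices

/-! ### Tangent vectors, normal components and the curvature estimate. -/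

section Geometry

variable {d : ℕ} {n : Fin d → ℕ}

theorem rank_le_of_mem_localOrbit {α : Finset (Fin d)} {v x : TensorSpace n}
    (h : x ∈ localOrbit α v ∨ x ∈ localOrbit αᶜ v) :
    (matricisation x α).rank ≤ (matricisation v α).rank := by
  rcases h with h | h
  · obtain ⟨T, hT, rfl⟩ := mem_localOrbit.1 h
    obtain ⟨M, hM⟩ := matricisation_local_left hT
    rw [hM]
    exact Matrix.rank_mul_le_right _ _
  · obtain ⟨T, hT, rfl⟩ := mem_localOrbit.1 h
    obtain ⟨M, hM⟩ := matricisation_local_right hT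
    rw [hM]
    exact Matrix.rank_mul_le_left _ _

/-- Tensors which at every node leave the row or the column space of `v` fixed are tangent. -/
theorem mem_tangentSpaceAt_of_mem_localOrbit {S : Finset (Finset (Fin d))}
    {r : Finset (Fin d) → ℕ} {v x : TensorSpace n} (hv : v ∈ rankEq n S r)
    (hx : ∀ γ ∈ S, x ∈ localOrbit γ v ∨ x ∈ localOrbit γᶜ v) :
    x ∈ tangentSpaceAt (rankEq n S r) v := by
  -- A straight line suffices: it stays in one orbit at each node, so ranks cannot rise, and
  -- semicontinuity keeps them from dropping near `t = 0`.
  refine Submodule.subset_span ⟨fun t => v + t • x, by simp, ?_, ?_⟩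
  · have hcont : Tendsto (fun t : ℝ => v + t • x) (𝓝 0) (𝓝 v) := by
      have : Continuous fun t : ℝ => v + t • x := by fun_prop
      simpa using this.tendsto 0
    refine (Filter.eventually_all_finset S).2 fun γ hγ => ?_
    have h1 := (((continuous_matricisation γ).tendsto v).comp hcont).eventually
      (eventually_rank_le _)
    filter_upwards [h1] with t ht
    refine le_antisymm ?_ ((hv γ hγ).symm.le.trans ht)
    rw [← hv γ hγ]
    apply rank_le_of_mem_localOrbit
    rcases hx γ hγ with h | h
    · exact Or.inl (add_mem (self_mem_localOrbit _ _) (Submodule.smul_mem _ _ h))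
    · exact Or.inr (add_mem (self_mem_localOrbit _ _) (Submodule.smul_mem _ _ h))
  · simpa using ((hasDerivAt_id (0 : ℝ)).smul_const x).const_add v

theorem self_mem_tangentSpaceAt {S : Finset (Finset (Fin d))}
    {r : Finset (Fin d) → ℕ} {v : TensorSpace n} (hv : v ∈ rankEq n S r) :
    v ∈ tangentSpaceAt (rankEq n S r) v :=
  mem_tangentSpaceAt_of_mem_localOrbit hv fun _ _ => Or.inl (self_mem_localOrbit _ _)

theorem orbitProj_of_mem {α : Finset (Fin d)} {v x : TensorSpace n} (h : x ∈ localOrbit α v) :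
    orbitProj α v x = x :=
  Submodule.starProjection_eq_self_iff.2 h

theorem orbitProj_mem (α : Finset (Fin d)) (v x : TensorSpace n) :
    orbitProj α v x ∈ localOrbit α v :=
  Submodule.starProjection_apply_mem _ _

theorem norm_orbitProj_le (α : Finset (Fin d)) (v x : TensorSpace n) :
    ‖orbitProj α v x‖ ≤ ‖x‖ :=
  Submodule.norm_starProjection_apply_le _ _

theorem norm_one_sub_orbitProj_le (α : Finset (Fin d)) (v x : TensorSpace n) :
    ‖(1 - orbitProj α v) x‖ ≤ ‖x‖ := by
  rw [orbitProj, ← Submodule.starProjection_orthogonal']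
  exact Submodule.norm_starProjection_apply_le _ _

theorem one_sub_orbitProj_self (α : Finset (Fin d)) (v : TensorSpace n) :
    (1 - orbitProj α v) v = 0 := by
  simp [orbitProj_of_mem (self_mem_localOrbit α v)]

theorem exists_matricisation_one_sub_left (α : Finset (Fin d)) (v : TensorSpace n) :
    ∃ M : Matrix (∀ i : {i // i ∈ α}, Fin (n i)) (∀ i : {i // i ∈ α}, Fin (n i)) ℝ,
      ∀ x, matricisation ((1 - orbitProj αᶜ v) x) α = M * matricisation x α := by
  apply matricisation_local_left
  have := orbitProj_mem_localOperators αᶜ v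
  rw [compl_compl] at this
  exact sub_mem (one_mem _) this

theorem exists_matricisation_one_sub_right (α : Finset (Fin d)) (v : TensorSpace n) :
    ∃ N : Matrix (∀ i : {i // ¬ i ∈ α}, Fin (n i)) (∀ i : {i // ¬ i ∈ α}, Fin (n i)) ℝ,
      ∀ x, matricisation ((1 - orbitProj α v) x) α = matricisation x α * N :=
  matricisation_local_right (sub_mem (one_mem _) (orbitProj_mem_localOperators α v))

theorem normalProj_apply_eq_zero {S : Finset (Finset (Fin d))} {r : Finset (Fin d) → ℕ}
    {v ξ : TensorSpace n} (hξ : ξ ∈ tangentSpaceAt (rankEq n S r) v)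
    {α : Finset (Fin d)} (hα : α ∈ S) : normalProj α v ξ = 0 := by
  suffices h : tangentSpaceAt (rankEq n S r) v ≤ LinearMap.ker (normalProj α v).toLinearMap from
    h hξ
  refine Submodule.span_le.2 ?_
  rintro ξ ⟨γ, rfl, hγ, hd⟩
  obtain ⟨M, hM⟩ := exists_matricisation_one_sub_left α (γ 0)
  obtain ⟨N, hN⟩ := exists_matricisation_one_sub_right α (γ 0)
  have hM0 : M * matricisation (γ 0) α = 0 := by
    rw [← hM, one_sub_orbitProj_self, matricisation_zero]
  have hN0 : matricisation (γ 0) α * N = 0 := by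
    rw [← hN, one_sub_orbitProj_self, matricisation_zero]
  apply matricisation_injective α
  change matricisation ((1 - orbitProj αᶜ (γ 0)) ((1 - orbitProj α (γ 0)) ξ)) α = matricisation 0 α
  rw [hM, hN, matricisation_zero, ← Matrix.mul_assoc]
  refine mul_velocity_mul_eq_zero (Γ := fun t => matricisation (γ t) α) hM0 hN0 ?_ ?_ ?_
  · have h0 := hγ.self_of_nhds α hα
    filter_upwards [hγ.filter_mono nhdsWithin_le_nhds] with t ht
    exact ((ht α hα).trans h0.symm).le
  · exact ((continuous_matricisation α).tendsto _).comp
      (hd.continuousAt.tendsto.mono_left nhdsWithin_le_nhds)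
  · have h1 := hasDerivAt_iff_tendsto_slope_zero.1 hd
    simp only [zero_add] at h1
    exact ((continuous_matricisation α).tendsto _).comp h1

/-- A vanishing normal component leaves a sum of two terms, one with columns in the column space of
`v` and one with rows in its row space, each of rank at most `r α`. -/
theorem rank_tangent_le {S : Finset (Finset (Fin d))} {r : Finset (Fin d) → ℕ}
    {v ξ : TensorSpace n} (hv : v ∈ rankEq n S r)
    (hξ : ξ ∈ tangentSpaceAt (rankEq n S r) v) {α : Finset (Fin d)} (hα : α ∈ S) :
    (matricisation ξ α).rank ≤ 2 * r α := by
  have h0 := normalProj_apply_eq_zero hξ hα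
  have hc : orbitProj α v (orbitProj αᶜ v ξ) = orbitProj αᶜ v (orbitProj α v ξ) :=
    DFunLike.congr_fun (orbitProj_commute_of_compl_subset (Finset.Subset.refl αᶜ) v) ξ
  have e : ξ = orbitProj αᶜ v ξ + orbitProj α v (ξ - orbitProj αᶜ v ξ) := by
    rw [map_sub, hc]
    have h1 : normalProj α v ξ = ξ - orbitProj α v ξ - orbitProj αᶜ v (ξ - orbitProj α v ξ) := rfl
    rw [h1, map_sub] at h0
    rw [← sub_eq_zero, ← h0]
    abel
  rw [e, matricisation_add]
  have hr1 := rank_le_of_mem_localOrbit (α := α) (Or.inr (orbitProj_mem αᶜ v ξ))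
  have hr2 := rank_le_of_mem_localOrbit (α := α)
    (Or.inl (orbitProj_mem α v (ξ - orbitProj αᶜ v ξ)))
  have := rank_add_le (matricisation (orbitProj αᶜ v ξ) α)
    (matricisation (orbitProj α v (ξ - orbitProj αᶜ v ξ)) α)
  rw [hv α hα] at hr1 hr2
  omega

/-- Since `U = U G U`, the normal component factors as `((1 - P_col) U) G (U (1 - P_row))`. Both
outer factors annihilate `v`, so `u` may be replaced by `u - v` in each. The constant is the norm of
the bilinear map `(x, y) ↦ x G y`, which does not involve `v`. -/
theorem exists_normalProj_le (α : Finset (Fin d)) (u : TensorSpace n) :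
    ∃ C : ℝ, 0 ≤ C ∧ ∀ v, ‖normalProj α v u‖ ≤ C * ‖u - v‖ ^ 2 := by
  obtain ⟨G, hG⟩ := exists_generalized_inverse (matricisation u α)
  let B : TensorSpace n →ₗ[ℝ] TensorSpace n →ₗ[ℝ] TensorSpace n :=
    LinearMap.mk₂ ℝ (fun x y => ofMatricisation α (matricisation x α * G * matricisation y α))
      (fun x x' y => by
        apply matricisation_injective α
        simp only [matricisation_add, matricisation_ofMatricisation, Matrix.add_mul])
      (fun c x y => by
        apply matricisation_injective α
        simp only [matricisation_smul, matricisation_ofMatricisation, Matrix.smul_mul])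
      (fun x y y' => by
        apply matricisation_injective α
        simp only [matricisation_add, matricisation_ofMatricisation, Matrix.mul_add])
      (fun c x y => by
        apply matricisation_injective α
        simp only [matricisation_smul, matricisation_ofMatricisation, Matrix.mul_smul])
  refine ⟨‖B.toContinuousBilinearMap‖, ContinuousLinearMap.opNorm_nonneg _, fun v => ?_⟩
  obtain ⟨M, hM⟩ := exists_matricisation_one_sub_left α v
  obtain ⟨N, hN⟩ := exists_matricisation_one_sub_right α v
  have e1 : ∀ β, (1 - orbitProj β v) u = (1 - orbitProj β v) (u - v) := fun β => by
    rw [map_sub, one_sub_orbitProj_self, sub_zero]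
  have e : normalProj α v u = B.toContinuousBilinearMap ((1 - orbitProj αᶜ v) (u - v))
      ((1 - orbitProj α v) (u - v)) := by
    rw [← e1, ← e1]
    apply matricisation_injective α
    change matricisation ((1 - orbitProj αᶜ v) ((1 - orbitProj α v) u)) α =
      matricisation (ofMatricisation α (matricisation _ α * G * matricisation _ α)) α
    rw [matricisation_ofMatricisation, hM, hM, hN]
    conv_lhs => rw [← hG]
    simp only [Matrix.mul_assoc]
  rw [e]
  refine (ContinuousLinearMap.le_opNorm₂ _ _ _).trans ?_
  rw [mul_assoc, sq]
  gcongr <;> exact norm_one_sub_orbitProj_le _ _ _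

/-- The projections attached to nested or disjoint nodes commute, so the nodes can be treated one at
a time in order of cardinality, each costing only its own normal component. -/
theorem exists_tangent_approx {S : Finset (Finset (Fin d))} {r : Finset (Fin d) → ℕ}
    (hS : ∀ α ∈ S, ∀ β ∈ S, α ⊆ β ∨ β ⊆ α ∨ Disjoint α β)
    {v : TensorSpace n} (hv : v ∈ rankEq n S r) (w : TensorSpace n) :
    ∃ x ∈ tangentSpaceAt (rankEq n S r) v, ‖w - x‖ ≤ ∑ α ∈ S, ‖normalProj α v w‖ := by
  -- `K` is the product of the column-space projections `orbitProj γᶜ v` over the nodes treated so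
  -- far. Closure of `s` under smaller nodes ensures that everything strictly inside the next node
  -- has been treated.
  have key : ∀ s : Finset (Finset (Fin d)), s ⊆ S → (∀ β ∈ s, ∀ γ ∈ S, γ ⊂ β → γ ∈ s) →
      ∃ K : TensorSpace n →L[ℝ] TensorSpace n, (∀ y, ‖K y‖ ≤ ‖y‖) ∧
        (∀ T, (∀ γ ∈ s, Commute T (orbitProj γᶜ v)) → Commute T K) ∧
        (∀ γ ∈ s, ∀ y, K y ∈ localOrbit γᶜ v) ∧
        ∃ x ∈ tangentSpaceAt (rankEq n S r) v,
          ‖w - x - K w‖ ≤ ∑ α ∈ s, ‖normalProj α v w‖ := by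
    intro s
    refine Finset.induction_on_max_value (Finset.card : Finset (Fin d) → ℕ) s ?_ ?_
    · intro _ _
      exact ⟨1, fun y => le_rfl, fun T _ => Commute.one_right T, by simp, 0, zero_mem _, by simp⟩
    · intro a s ha hmax ih hsub hlow
      have haS : a ∈ S := hsub (Finset.mem_insert_self _ _)
      have hsS : s ⊆ S := (Finset.subset_insert _ _).trans hsub
      have hbelow : ∀ γ ∈ s, γ ⊆ a ∨ Disjoint γ a := by
        intro γ hγ
        rcases hS γ (hsS hγ) a haS with h | h | h
        · exact Or.inl h
        · exact Or.inl (Finset.eq_of_subset_of_card_le h (hmax γ hγ)).ge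
        · exact Or.inr h
      obtain ⟨K, hK1, hK2, hK3, x, hx, hxw⟩ := ih hsS (by
        intro β hβ γ hγ hγβ
        rcases Finset.mem_insert.1 (hlow β (Finset.mem_insert_of_mem hβ) γ hγ hγβ) with h | h
        · subst h
          exact absurd (Finset.card_lt_card hγβ) (not_lt.2 (hmax β hβ))
        · exact h)
      have hcA : ∀ γ ∈ s, Commute (orbitProj a v) (orbitProj γᶜ v) := by
        intro γ hγ
        rcases hbelow γ hγ with h | h
        · exact orbitProj_commute_of_compl_subset (Finset.compl_subset_compl.2 h) v
        · exact orbitProj_commute_of_subset (Finset.subset_compl_iff_disjoint_left.2 h) v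
      have hcB : ∀ γ ∈ s, Commute (orbitProj aᶜ v) (orbitProj γᶜ v) := by
        intro γ hγ
        rcases hbelow γ hγ with h | h
        · exact orbitProj_commute_of_subset (Finset.compl_subset_compl.2 h) v
        · refine orbitProj_commute_of_compl_subset ?_ v
          rw [compl_compl]
          exact Finset.subset_compl_iff_disjoint_left.2 h
      have hcN : Commute (normalProj a v) K := hK2 _ fun γ hγ =>
        ((Commute.one_left _).sub_left (hcB γ hγ)).mul_left
          ((Commute.one_left _).sub_left (hcA γ hγ))
      refine ⟨orbitProj aᶜ v * K, fun y => (norm_orbitProj_le _ _ _).trans (hK1 y), ?_, ?_, ?_⟩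
      · intro T hT
        exact (hT a (Finset.mem_insert_self _ _)).mul_right
          (hK2 T fun γ hγ => hT γ (Finset.mem_insert_of_mem hγ))
      · intro γ hγ y
        rcases Finset.mem_insert.1 hγ with rfl | hγ
        · exact orbitProj_mem _ _ _
        · have h1 := DFunLike.congr_fun (hcB γ hγ) (K y)
          simp only [mul_apply_eq_comp, orbitProj_of_mem (hK3 γ hγ y)] at h1
          rw [mul_apply_eq_comp, h1]
          exact orbitProj_mem _ _ _
      · have hcomm : orbitProj aᶜ v (orbitProj a v (K w)) = orbitProj a v (orbitProj aᶜ v (K w)) :=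
          (DFunLike.congr_fun
            (orbitProj_commute_of_compl_subset (Finset.Subset.refl aᶜ) v) (K w)).symm
        -- The splitting is `K w = normalProj a v (K w) + orbitProj aᶜ v (K w) + z`. The part `z` is
        -- tangent: for nodes strictly inside `a` it inherits the column space from `K w`, and for
        -- nodes containing or disjoint from `a` it suffices that `z` lies in the orbit of `a`.
        set z := orbitProj a v (K w - orbitProj aᶜ v (K w)) with hz
        have hza : z ∈ localOrbit a v := orbitProj_mem _ _ _
        have hzT : z ∈ tangentSpaceAt (rankEq n S r) v := by
          refine mem_tangentSpaceAt_of_mem_localOrbit hv fun γ hγ => ?_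
          rcases hS γ hγ a haS with h | h | h
          · rcases h.eq_or_ssubset with rfl | h'
            · exact Or.inl hza
            · have hγs : γ ∈ s := by
                rcases Finset.mem_insert.1
                  (hlow a (Finset.mem_insert_self _ _) γ hγ h') with h'' | h''
                · exact absurd h'' h'.ne
                · exact h''
              have h1 := DFunLike.congr_fun (hcB γ hγs) (K w)
              simp only [mul_apply_eq_comp, orbitProj_of_mem (hK3 γ hγs w)] at h1
              have h2 : K w - orbitProj aᶜ v (K w) ∈ localOrbit γᶜ v := by
                refine sub_mem (hK3 γ hγs w) ?_
                rw [h1]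
                exact orbitProj_mem _ _ _
              have h3 := DFunLike.congr_fun (hcA γ hγs) (K w - orbitProj aᶜ v (K w))
              simp only [mul_apply_eq_comp, orbitProj_of_mem h2] at h3
              refine Or.inr ?_
              rw [hz, h3]
              exact orbitProj_mem _ _ _
          · exact Or.inl (localOrbit_mono h v hza)
          · exact Or.inr (localOrbit_mono (Finset.subset_compl_iff_disjoint_left.2 h) v hza)
        refine ⟨x + z, add_mem hx hzT, ?_⟩
        have e : w - (x + z) - (orbitProj aᶜ v * K) w = K (normalProj a v w) + (w - x - K w) := by
          have h1 : K (normalProj a v w) = normalProj a v (K w) :=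
            (DFunLike.congr_fun hcN w).symm
          have h2 : normalProj a v (K w) =
              K w - orbitProj a v (K w) - orbitProj aᶜ v (K w - orbitProj a v (K w)) := rfl
          rw [h1, h2, map_sub, hz, map_sub, hcomm, mul_apply_eq_comp]
          abel
        rw [e, Finset.sum_insert ha]
        exact (norm_add_le _ _).trans (add_le_add (hK1 _) hxw)
  obtain ⟨K, -, -, hK3, x, hx, hxw⟩ := key S subset_rfl fun _ _ _ h _ => h
  refine ⟨x + K w, add_mem hx ?_, by rwa [← sub_sub]⟩
  exact mem_tangentSpaceAt_of_mem_localOrbit hv fun γ hγ => Or.inr (hK3 γ hγ w)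

/-- The tangent spaces at points near `u` contain the secants to `u` up to second order. -/
theorem exists_norm_sub_tangentProj_le {S : Finset (Finset (Fin d))} {r : Finset (Fin d) → ℕ}
    (hS : ∀ α ∈ S, ∀ β ∈ S, α ⊆ β ∨ β ⊆ α ∨ Disjoint α β) (u : TensorSpace n) :
    ∃ C : ℝ, 0 ≤ C ∧ ∀ v ∈ rankEq n S r,
      ‖(u - v) - (tangentSpaceAt (rankEq n S r) v).starProjection (u - v)‖ ≤ C * ‖u - v‖ ^ 2 := by
  choose C hC0 hC using fun α => exists_normalProj_le (n := n) α u
  refine ⟨∑ α ∈ S, C α, Finset.sum_nonneg fun α _ => hC0 α, fun v hv => ?_⟩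
  obtain ⟨x, hx, hxw⟩ := exists_tangent_approx hS hv (u - v)
  calc _ ≤ ‖(u - v) - x‖ := by
        rw [Submodule.starProjection_minimal]
        exact ciInf_le ⟨0, by rintro _ ⟨y, rfl⟩; exact norm_nonneg _⟩
          (⟨x, hx⟩ : tangentSpaceAt (rankEq n S r) v)
    _ ≤ ∑ α ∈ S, ‖normalProj α v (u - v)‖ := hxw
    _ ≤ ∑ α ∈ S, C α * ‖u - v‖ ^ 2 := by
        refine Finset.sum_le_sum fun α _ => ?_
        have : normalProj α v (u - v) = normalProj α v u := by
          have h0 : normalProj α v v = 0 := by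
            change (1 - orbitProj αᶜ v) ((1 - orbitProj α v) v) = 0
            rw [one_sub_orbitProj_self, map_zero]
          rw [map_sub, h0, sub_zero]
        rw [this]
        exact hC α v
    _ = _ := by rw [Finset.sum_mul]

end Geometry

/-! ### Uniform retraction error and restricted isometry on a subspace. -/

section Analysis

/-- The error of a retraction is of first order small, uniformly near a point of `M`. -/
theorem IsRetraction.exists_norm_sub_le {H : Type*} [NormedAddCommGroup H] [InnerProductSpace ℝ H]
    {M : Set H} {D : Set (H × H)} {R : H × H → H} (hR : IsRetraction M D R) {u : H} (hu : u ∈ M)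
    {η : ℝ} (hη : 0 < η) :
    ∃ ε > 0, ∀ v ∈ M, ∀ ξ ∈ tangentSpaceAt M v, ‖v - u‖ < ε → ‖ξ‖ < ε →
      (v, ξ) ∈ D ∧ ‖R (v, ξ) - v - ξ‖ ≤ η * ‖ξ‖ := by
  obtain ⟨R', hR', hdiff⟩ := hR.twiceDifferentiable
  have hu0 : ((u, 0) : H × H) ∈ tangentPairs M := ⟨hu, zero_mem _⟩
  obtain ⟨ε₁, hε₁, hball⟩ := Metric.mem_nhdsWithin_iff.1 (hR.nhds_zero u hu)
  have huD : ((u, 0) : H × H) ∈ D := hball ⟨Metric.mem_ball_self hε₁, hu0⟩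
  -- The quadratic bound on the retraction has a constant depending on `v`; uniformity near `u`
  -- comes from this continuity instead.
  have hcw : ContinuousWithinAt R' D (u, 0) := (hdiff (u, 0) huD).continuousWithinAt
  obtain ⟨ε₂, hε₂, hcont⟩ := Metric.mem_nhdsWithin_iff.1
    (hcw.preimage_mem_nhdsWithin (Metric.closedBall_mem_nhds (R' (u, 0)) (half_pos hη)))
  refine ⟨min ε₁ ε₂, lt_min hε₁ hε₂, fun v hv ξ hξ hvu hξε => ?_⟩
  have hdist : ∀ t ∈ Set.Icc (0 : ℝ) 1, dist ((v, t • ξ) : H × H) (u, 0) < min ε₁ ε₂ := by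
    intro t ht
    rw [Prod.dist_eq, max_lt_iff, dist_eq_norm, dist_zero_right, norm_smul, Real.norm_eq_abs,
      abs_of_nonneg ht.1]
    exact ⟨hvu, (mul_le_of_le_one_left (norm_nonneg _) ht.2).trans_lt hξε⟩
  have hD : ∀ t ∈ Set.Icc (0 : ℝ) 1, ((v, t • ξ) : H × H) ∈ D := fun t ht =>
    hball ⟨(hdist t ht).trans_le (min_le_left _ _), hv, Submodule.smul_mem _ _ hξ⟩
  have hR'near : ∀ t ∈ Set.Icc (0 : ℝ) 1, ‖R' (v, t • ξ) - R' (u, 0)‖ ≤ η / 2 := fun t ht => by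
    exact (mem_closedBall_iff_norm (E := H × H →L[ℝ] H)).1 (Set.mem_preimage.1
      (hcont ⟨(hdist t ht).trans_le (min_le_right _ _), hD t ht⟩))
  have h0 : (0 : ℝ) ∈ Set.Icc (0 : ℝ) 1 := by simp
  have hderiv : ∀ t ∈ Set.Icc (0 : ℝ) 1, HasDerivWithinAt (fun t : ℝ => R (v, t • ξ))
      (R' (v, t • ξ) (0, ξ)) (Set.Icc 0 1) t := by
    intro t ht
    have hc : HasDerivWithinAt (fun t : ℝ => ((v, t • ξ) : H × H)) (0, ξ) (Set.Icc 0 1) t := by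
      have h1 := (hasDerivAt_id t).smul_const ξ
      rw [one_smul] at h1
      exact ((hasDerivAt_const t v).prodMk h1).hasDerivWithinAt
    exact (hR' _ (hD t ht)).comp_hasDerivWithinAt t hc hD
  -- The quadratic bound is used only to identify the derivative at the zero vector as the identity
  -- on tangent vectors.
  have hderiv0 : HasDerivWithinAt (fun t : ℝ => R (v, t • ξ)) ξ (Set.Icc 0 1) 0 := by
    rw [hasDerivWithinAt_iff_isLittleO]
    have htend : Tendsto (fun t : ℝ => t • ξ) (𝓝[Set.Icc 0 1] 0)
        (𝓝[(tangentSpaceAt M v : Set H)] 0) := by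
      refine tendsto_nhdsWithin_iff.2 ⟨?_, Eventually.of_forall fun t =>
        Submodule.smul_mem _ _ hξ⟩
      have : Continuous fun t : ℝ => t • ξ := by fun_prop
      simpa using (this.tendsto 0).mono_left nhdsWithin_le_nhds
    have hO := (hR.isBigO v hv).comp_tendsto htend
    have hsq : (fun t : ℝ => ‖t • ξ‖ ^ 2) =o[𝓝[Set.Icc 0 1] 0] fun t : ℝ => t - 0 := by
      have h2 : (fun t : ℝ => t ^ 2) =o[𝓝 0] fun t : ℝ => t := by
        simpa using Asymptotics.isLittleO_pow_pow (𝕜 := ℝ) one_lt_two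
      have h3 := (h2.mono (nhdsWithin_le_nhds (s := Set.Icc 0 1))).const_mul_left (‖ξ‖ ^ 2)
      refine h3.congr (fun t => ?_) fun t => by simp
      rw [norm_smul, mul_pow, Real.norm_eq_abs, sq_abs, mul_comm]
    refine ((hO.trans_isLittleO hsq).neg_left).congr (fun t => ?_) fun t => rfl
    simp only [Function.comp_apply, zero_smul, hR.map_zero v hv, sub_zero]
    abel
  have hξeq : R' (v, (0 : ℝ) • ξ) (0, ξ) = ξ :=
    (uniqueDiffOn_Icc (zero_lt_one' ℝ) 0 h0).eq_deriv _ (hderiv 0 h0) hderiv0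
  refine ⟨by simpa using hD 1 (by simp), ?_⟩
  have hmv := (convex_Icc (0 : ℝ) 1).norm_image_sub_le_of_norm_hasDerivWithin_le
    (f := fun t : ℝ => R (v, t • ξ) - t • ξ) (f' := fun t => R' (v, t • ξ) (0, ξ) - ξ)
    (C := η * ‖ξ‖) (fun t ht => (hderiv t ht).sub (by
      simpa using ((hasDerivAt_id t).smul_const ξ).hasDerivWithinAt)) (fun t ht => ?_) h0
    (by simp : (1 : ℝ) ∈ Set.Icc (0 : ℝ) 1)
  · simp only [one_smul, zero_smul, hR.map_zero v hv, sub_zero, norm_one, mul_one] at hmv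
    rwa [sub_right_comm] at hmv
  · have e : R' (v, t • ξ) (0, ξ) - ξ = (R' (v, t • ξ) - R' (v, (0 : ℝ) • ξ)) (0, ξ) := by
      rw [sub_apply, hξeq]
    rw [e]
    refine (ContinuousLinearMap.le_opNorm _ _).trans ?_
    have h1 : ‖R' (v, t • ξ) - R' (v, (0 : ℝ) • ξ)‖ ≤ η := by
      rw [← sub_sub_sub_cancel_right _ _ (R' (u, 0))]
      exact (norm_sub_le (E := H × H →L[ℝ] H) _ _).trans
        ((add_le_add (hR'near t ht) (hR'near 0 h0)).trans_eq (add_halves η))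
    have h2 : ‖((0 : H), ξ)‖ = ‖ξ‖ := by simp [Prod.norm_def]
    rw [h2]
    gcongr

variable {H F : Type*} [NormedAddCommGroup H] [InnerProductSpace ℝ H] [FiniteDimensional ℝ H]
  [NormedAddCommGroup F] [InnerProductSpace ℝ F] [FiniteDimensional ℝ F]

/-- If `A` is almost isometric on `T`, then `P_T A^* A` is near the identity on `T`. -/
theorem norm_sub_proj_adjoint_le (T : Submodule ℝ H) (A : H →ₗ[ℝ] F) {δ : ℝ} (hδ : 0 < δ)
    (hA : ∀ τ ∈ T, (1 - δ) * ‖τ‖ ^ 2 ≤ ‖A τ‖ ^ 2 ∧ ‖A τ‖ ^ 2 ≤ (1 + δ) * ‖τ‖ ^ 2)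
    {τ : H} (hτ : τ ∈ T) :
    ‖τ - T.starProjection (LinearMap.adjoint A (A τ))‖ ≤ δ * ‖τ‖ := by
  set q := τ - T.starProjection (LinearMap.adjoint A (A τ)) with hq
  have hqT : q ∈ T := sub_mem hτ (Submodule.starProjection_apply_mem _ _)
  have h1 : ‖q‖ ^ 2 = inner ℝ q τ - inner ℝ (A q) (A τ) := by
    rw [← real_inner_self_eq_norm_sq]
    conv_lhs => rw [hq, inner_sub_right, ← hq]
    rw [← Submodule.inner_starProjection_left_eq_right, Submodule.starProjection_eq_self_iff.2 hqT,
      LinearMap.adjoint_inner_right]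
  -- Polarisation with weight `δ`: subtracting the two bounds leaves `4δ‖q‖² ≤ 2δ(‖q‖² + δ²‖τ‖²)`,
  -- which is the sharp estimate.
  have h2 := (hA (q + δ • τ) (add_mem hqT (T.smul_mem _ hτ))).1
  have h3 := (hA (q - δ • τ) (sub_mem hqT (T.smul_mem _ hτ))).2
  rw [map_add, map_smul, norm_add_sq_real, norm_add_sq_real, inner_smul_right, inner_smul_right,
    norm_smul, norm_smul, mul_pow, mul_pow, Real.norm_eq_abs, sq_abs] at h2
  rw [map_sub, map_smul, norm_sub_sq_real, norm_sub_sq_real, inner_smul_right, inner_smul_right,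
    norm_smul, norm_smul, mul_pow, mul_pow, Real.norm_eq_abs, sq_abs] at h3
  have h4 : δ * ‖q‖ ^ 2 ≤ δ * (δ * ‖τ‖) ^ 2 := by
    have h5 : δ * ‖q‖ ^ 2 = δ * inner ℝ q τ - δ * inner ℝ (A q) (A τ) := by rw [h1]; ring
    nlinarith
  exact le_of_sq_le_sq (le_of_mul_le_mul_left h4 hδ) (by positivity)

theorem norm_adjoint_le (A : H →ₗ[ℝ] F) {B : ℝ} (hB : 0 ≤ B) (hA : ∀ x, ‖A x‖ ≤ B * ‖x‖)
    (y : F) : ‖LinearMap.adjoint A y‖ ≤ B * ‖y‖ := by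
  rcases eq_or_lt_of_le (norm_nonneg (LinearMap.adjoint A y)) with h | h
  · rw [← h]
    positivity
  · have h1 : ‖LinearMap.adjoint A y‖ ^ 2 ≤ ‖y‖ * (B * ‖LinearMap.adjoint A y‖) := by
      rw [← real_inner_self_eq_norm_sq, LinearMap.adjoint_inner_left]
      exact (real_inner_le_norm _ _).trans (by gcongr; exact hA _)
    nlinarith

end Analysis

/-! ### Bounds on the measurement map and contraction of one step. -/

section Convergence

variable {d : ℕ} {n : Fin d → ℕ}

theorem rank_matricisation_single_le (μ : ∀ i, Fin (n i)) (α : Finset (Fin d)) :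
    (matricisation (EuclideanSpace.single μ (1 : ℝ)) α).rank ≤ 1 := by
  classical
  let I₀ : ∀ i : {i // i ∈ α}, Fin (n i) := fun i => μ i
  let J₀ : ∀ i : {i // ¬ i ∈ α}, Fin (n i) := fun i => μ i
  have e : matricisation (EuclideanSpace.single μ (1 : ℝ)) α =
      Matrix.vecMulVec (fun I : ∀ i : {i // i ∈ α}, Fin (n i) => if I = I₀ then (1 : ℝ) else 0)
        (fun J : ∀ i : {i // ¬ i ∈ α}, Fin (n i) => if J = J₀ then 1 else 0) := by
    ext I J
    rw [matricisation_apply, PiLp.single_apply, Matrix.vecMulVec_apply]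
    have : joinIndex α I J = μ ↔ (I = I₀) ∧ J = J₀ := by
      constructor
      · rintro rfl
        constructor <;> funext i <;> simp [I₀, J₀, joinIndex, i.2]
      · rintro ⟨hI, hJ⟩
        rw [hI, hJ]
        funext i
        simp [I₀, J₀, joinIndex]
    simp only [this]
    by_cases h1 : I = I₀ <;> by_cases h2 : J = J₀ <;> simp [h1, h2]
  rw [e]
  exact Matrix.rank_vecMulVec_le _ _

/-- Restricted isometry controls `A` on unit tensors, which have rank at most one. This turns that
control into a bound on the whole space independent of `A` and `m`, which makes the neighbourhood of
`u` uniform in the measurement map. -/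
theorem norm_le_of_single_le {m : ℕ} (A : TensorSpace n →ₗ[ℝ] EuclideanSpace ℝ (Fin m)) {c : ℝ}
    (hA : ∀ μ, ‖A (EuclideanSpace.single μ 1)‖ ≤ c) (x : TensorSpace n) :
    ‖A x‖ ≤ Fintype.card (∀ i, Fin (n i)) * c * ‖x‖ := by
  conv_lhs => rw [← (EuclideanSpace.basisFun (∀ i, Fin (n i)) ℝ).sum_repr x]
  rw [map_sum]
  refine (norm_sum_le _ _).trans ?_
  have : ∀ μ ∈ Finset.univ, ‖A ((EuclideanSpace.basisFun (∀ i, Fin (n i)) ℝ).repr x μ •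
      EuclideanSpace.basisFun (∀ i, Fin (n i)) ℝ μ)‖ ≤ c * ‖x‖ := by
    intro μ _
    rw [map_smul, norm_smul, EuclideanSpace.basisFun_apply, EuclideanSpace.basisFun_repr, mul_comm]
    exact mul_le_mul (hA μ) (PiLp.norm_apply_le x μ) (norm_nonneg _)
      ((norm_nonneg _).trans (hA μ))
  refine (Finset.sum_le_card_nsmul _ _ _ this).trans ?_
  rw [Finset.card_univ, nsmul_eq_mul, mul_assoc]

/-- The strict inequality provides an admissible constant below `δ`, so it does not matter whether
the infimum is attained. -/
theorem exists_tric_bound {m : ℕ} {S : Finset (Finset (Fin d))} {r : Finset (Fin d) → ℕ}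
    {A : TensorSpace n →ₗ[ℝ] EuclideanSpace ℝ (Fin m)} {δ : ℝ} (h : tric S r A < δ) :
    ∀ v ∈ rankLE n S r,
      (1 - δ) * ‖v‖ ^ 2 ≤ ‖A v‖ ^ 2 ∧ ‖A v‖ ^ 2 ≤ (1 + δ) * ‖v‖ ^ 2 := by
  obtain ⟨c, ⟨-, hc⟩, hcδ⟩ := exists_lt_of_csInf_lt (by
    refine ⟨1 + ‖LinearMap.toContinuousLinearMap A‖ ^ 2, by positivity, fun v _ => ⟨?_, ?_⟩⟩
    · nlinarith [sq_nonneg ‖A v‖, mul_nonneg (sq_nonneg ‖LinearMap.toContinuousLinearMap A‖)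
        (sq_nonneg ‖v‖)]
    · have h1 : ‖A v‖ ≤ ‖LinearMap.toContinuousLinearMap A‖ * ‖v‖ :=
        (LinearMap.toContinuousLinearMap A).le_opNorm v
      have h2 := pow_le_pow_left₀ (norm_nonneg _) h1 2
      nlinarith [sq_nonneg ‖v‖]) h
  intro v hv
  obtain ⟨h1, h2⟩ := hc v hv
  constructor <;> nlinarith [sq_nonneg ‖v‖]

/-- One step of the Riemannian gradient iteration is a contraction towards `u` near `u`. -/
theorem exists_step_contraction {S : Finset (Finset (Fin d))} {r : Finset (Fin d) → ℕ}
    (hS : ∀ α ∈ S, ∀ β ∈ S, α ⊆ β ∨ β ⊆ α ∨ Disjoint α β) (hr : ∀ α ∈ S, 1 ≤ r α)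
    {D : Set (TensorSpace n × TensorSpace n)} {R : TensorSpace n × TensorSpace n → TensorSpace n}
    (hR : IsRetraction (rankEq n S r) D R) {u : TensorSpace n} (hu : u ∈ rankEq n S r)
    {δ ρ : ℝ} (hδ : 0 < δ) (hδ1 : δ < 1) (hδρ : δ < ρ) :
    ∃ ε > 0, ∀ (m : ℕ) (A : TensorSpace n →ₗ[ℝ] EuclideanSpace ℝ (Fin m)),
      tric S (fun α => 3 * r α) A < δ → ∀ v ∈ rankEq n S r, ‖v - u‖ ≤ ε →
      (v, rgiDirection (rankEq n S r) A (A u) v) ∈ D ∧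
        ‖R (v, rgiDirection (rankEq n S r) A (A u) v) - u‖ ≤ ρ * ‖v - u‖ := by
  obtain ⟨C, hC0, hC⟩ := exists_norm_sub_tangentProj_le (r := r) hS u
  set B : ℝ := Fintype.card (∀ i, Fin (n i)) * 2 with hB
  have hB0 : 0 ≤ B := by positivity
  have hs : 0 < ρ - δ := sub_pos.2 hδρ
  have hη : 0 < (ρ - δ) / (2 * (B ^ 2 + 1)) := by positivity
  obtain ⟨ε₁, hε₁, hret⟩ := hR.exists_norm_sub_le hu hη
  -- The first bound keeps `v` and the direction, of norm at most `B²‖w‖`, inside the range of the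
  -- retraction estimate. The second makes the curvature term at most `(ρ - δ)/2 * ‖w‖`; the choice
  -- of `η` gives the retraction error the other half of the gap.
  refine ⟨min (ε₁ / (2 * (B ^ 2 + 1))) ((ρ - δ) / (2 * ((B ^ 2 + 1) * C + 1))),
    lt_min (by positivity) (by positivity), fun m A hA v hv hvu => ?_⟩
  have hRIP := exists_tric_bound hA
  have hAB : ∀ x, ‖A x‖ ≤ B * ‖x‖ := by
    refine norm_le_of_single_le A fun μ => ?_
    have h1 := (hRIP (EuclideanSpace.single μ 1) fun α hα =>
      (rank_matricisation_single_le μ α).trans (show 1 ≤ 3 * r α by have := hr α hα; omega)).2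
    rw [PiLp.norm_single, norm_one] at h1
    nlinarith [norm_nonneg (A (EuclideanSpace.single μ 1))]
  set T := tangentSpaceAt (rankEq n S r) v with hT
  have hTA : ∀ τ ∈ T, (1 - δ) * ‖τ‖ ^ 2 ≤ ‖A τ‖ ^ 2 ∧ ‖A τ‖ ^ 2 ≤ (1 + δ) * ‖τ‖ ^ 2 :=
    fun τ hτ => hRIP τ fun α hα => (rank_tangent_le hv hτ hα).trans
      (show 2 * r α ≤ 3 * r α by omega)
  have hvT : T.starProjection v = v :=
    Submodule.starProjection_eq_self_iff.2 (self_mem_tangentSpaceAt hv)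
  have hG : ∀ x, ‖T.starProjection (LinearMap.adjoint A (A x))‖ ≤ B ^ 2 * ‖x‖ := fun x =>
    calc _ ≤ ‖LinearMap.adjoint A (A x)‖ := Submodule.norm_starProjection_apply_le _ _
      _ ≤ B * ‖A x‖ := norm_adjoint_le A hB0 hAB _
      _ ≤ B * (B * ‖x‖) := by gcongr; exact hAB x
      _ = B ^ 2 * ‖x‖ := by ring
  set w := u - v with hw
  have hwv : ‖v - u‖ = ‖w‖ := norm_sub_rev _ _
  rw [hwv] at hvu ⊢
  have hdir : rgiDirection (rankEq n S r) A (A u) v =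
      T.starProjection (LinearMap.adjoint A (A w)) := by
    change T.starProjection (v + LinearMap.adjoint A (A u - A v)) - v = _
    rw [map_add, hvT, ← map_sub, ← hw, add_sub_cancel_left]
  rw [hdir]
  set ξ := T.starProjection (LinearMap.adjoint A (A w)) with hξ
  have hξw : ‖ξ‖ ≤ B ^ 2 * ‖w‖ := hG w
  have hξT : ξ ∈ T := Submodule.starProjection_apply_mem _ _
  have hw1 : ‖w‖ * (2 * (B ^ 2 + 1)) ≤ ε₁ :=
    (le_div_iff₀ (by positivity)).1 (hvu.trans (min_le_left _ _))
  have hw2 : ‖w‖ * (2 * ((B ^ 2 + 1) * C + 1)) ≤ ρ - δ :=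
    (le_div_iff₀ (by positivity)).1 (hvu.trans (min_le_right _ _))
  have hw0 := norm_nonneg w
  have hBw : 0 ≤ B ^ 2 * ‖w‖ := by positivity
  obtain ⟨hD, hRe⟩ := hret v hv ξ hξT (by rw [hwv]; nlinarith) (by nlinarith)
  refine ⟨hD, ?_⟩
  have hCw := hC v hv
  rw [← hw, ← hT] at hCw
  set p := T.starProjection w with hp
  have hp1 := norm_sub_proj_adjoint_le T A hδ hTA (Submodule.starProjection_apply_mem T w)
  rw [← hp] at hp1
  have hpw : ‖p‖ ≤ ‖w‖ := Submodule.norm_starProjection_apply_le _ _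
  have e : R (v, ξ) - u = (R (v, ξ) - v - ξ) - (p - T.starProjection (LinearMap.adjoint A (A p))) +
      (T.starProjection (LinearMap.adjoint A (A (w - p))) - (w - p)) := by
    rw [map_sub A, map_sub, map_sub, ← hξ, hw]
    abel
  have h1 : ‖R (v, ξ) - v - ξ‖ ≤ (ρ - δ) / 2 * ‖w‖ := by
    refine hRe.trans ?_
    rw [div_mul_eq_mul_div, div_le_iff₀ (by positivity)]
    nlinarith [mul_le_mul_of_nonneg_left hξw hs.le, mul_nonneg hs.le hw0]
  have h2 : ‖p - T.starProjection (LinearMap.adjoint A (A p))‖ ≤ δ * ‖w‖ :=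
    hp1.trans (by gcongr)
  have h3 : ‖T.starProjection (LinearMap.adjoint A (A (w - p))) - (w - p)‖ ≤
      (ρ - δ) / 2 * ‖w‖ :=
    calc _ ≤ B ^ 2 * ‖w - p‖ + ‖w - p‖ := (norm_sub_le _ _).trans (by gcongr; exact hG _)
      _ = (B ^ 2 + 1) * ‖w - p‖ := by ring
      _ ≤ (B ^ 2 + 1) * (C * ‖w‖ ^ 2) := by gcongr
      _ = (B ^ 2 + 1) * C * ‖w‖ * ‖w‖ := by ring
      _ ≤ (ρ - δ) / 2 * ‖w‖ := by gcongr; nlinarith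
  rw [e]
  refine (norm_add_le _ _).trans ?_
  have := norm_sub_le (R (v, ξ) - v - ξ) (p - T.starProjection (LinearMap.adjoint A (A p)))
  linarith

theorem eq_zero_of_rank_matricisation_eq_zero {u : TensorSpace n} {α : Finset (Fin d)}
    (h : (matricisation u α).rank = 0) : u = 0 := by
  classical
  have h1 := mul_eq_zero_of_rank_le (A := matricisation u α) (P := (0 : Matrix Unit _ ℝ))
    (N := (1 : Matrix (∀ i : {i // ¬ i ∈ α}, Fin (n i)) (∀ i : {i // ¬ i ∈ α}, Fin (n i)) ℝ))
    (by rw [h]; exact Nat.zero_le _) (by simp)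
  exact matricisation_injective α ((Matrix.mul_one _).symm.trans h1)

end Convergence

end HierTensor

/-! ### Assembly: choice of the rate, degenerate cases and induction over the iterates. -/

theorem theorem3 (δ : ℝ) (hδ : δ < 1) :
    ∃ ρ : ℝ → ℝ, (∀ ε : ℝ, 0 < ε → 0 < ρ ε ∧ ρ ε < 1) ∧
      ∀ (d : ℕ) (n : Fin d → ℕ) (𝕋 S : Finset (Finset (Fin d))),
      HierTensor.IsDimensionTree 𝕋 → S ⊆ 𝕋 →
      ∀ (r : Finset (Fin d) → ℕ)
        (D : Set (HierTensor.TensorSpace n × HierTensor.TensorSpace n))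
        (R : HierTensor.TensorSpace n × HierTensor.TensorSpace n → HierTensor.TensorSpace n),
      HierTensor.IsRetraction (HierTensor.rankEq n S r) D R →
      ∀ u ∈ HierTensor.rankLE n S r,
      ∃ ε₀ : ℝ, 0 < ε₀ ∧ ∀ ε : ℝ, 0 < ε → ε ≤ ε₀ →
        ∀ (m : ℕ) (A : HierTensor.TensorSpace n →ₗ[ℝ] EuclideanSpace ℝ (Fin m)),
        HierTensor.tric S (fun α => 3 * r α) A ≤ δ →
        ∀ x : ℕ → HierTensor.TensorSpace n,
        x 0 ∈ HierTensor.rankEq n S r →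
        ‖u - x 0‖ ≤ ε →
        ENNReal.ofReal ε < Metric.infEDist (x 0) (HierTensor.singularPoints n S r) →
        (∀ k, x (k + 1) =
          R (x k, HierTensor.rgiDirection (HierTensor.rankEq n S r) A (A u) (x k))) →
        (∀ k, x k ∈ HierTensor.rankEq n S r ∧
          (x k, HierTensor.rgiDirection (HierTensor.rankEq n S r) A (A u) (x k)) ∈ D) ∧
        (∀ k, ‖x (k + 1) - u‖ ≤ ρ ε * ‖x k - u‖) ∧
        Tendsto x atTop (𝓝 u) := by
  -- The enlarged constant is positive even when `δ` is not, and strictly above `δ`, as the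
  -- contraction lemma requires. The rate `ρ` is then halfway from `δ'` to `1`, constant in `ε`.
  set δ' : ℝ := (1 + max δ 0) / 2 with hδ'
  have hm0 : (0 : ℝ) ≤ max δ 0 := le_max_right _ _
  have hm1 : max δ 0 < 1 := max_lt hδ one_pos
  have hmδ : δ ≤ max δ 0 := le_max_left _ _
  have hδ'0 : 0 < δ' := by rw [hδ']; linarith
  have hδ'1 : δ' < 1 := by rw [hδ']; linarith
  have hδδ' : δ < δ' := by rw [hδ']; linarith
  set ρ : ℝ := (1 + δ') / 2 with hρ
  have hρ0 : 0 < ρ := by rw [hρ]; linarith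
  have hρ1 : ρ < 1 := by rw [hρ]; linarith
  have hδρ : δ' < ρ := by rw [hρ]; linarith
  refine ⟨fun _ => ρ, fun _ _ => ⟨hρ0, hρ1⟩, ?_⟩
  intro d n 𝕋 S h𝕋 hS𝕋 r D R hR u hu
  have hS : ∀ α ∈ S, ∀ β ∈ S, α ⊆ β ∨ β ⊆ α ∨ Disjoint α β := fun α hα β hβ =>
    h𝕋.nested_or_disjoint α (hS𝕋 hα) β (hS𝕋 hβ)
  by_cases hueq : u ∈ HierTensor.rankEq n S r
  swap
  -- Here `u` is itself a singular point within `ε` of the starting point, so the threshold `1` is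
  -- arbitrary.
  · refine ⟨1, one_pos, fun ε _ _ m A _ x _ hux hdist => absurd hdist (not_lt.2 ?_)⟩
    refine (Metric.infEDist_le_edist_of_mem
      (show u ∈ HierTensor.singularPoints n S r from ⟨hu, hueq⟩)).trans ?_
    rw [edist_comm, edist_dist, dist_eq_norm]
    exact ENNReal.ofReal_le_ofReal hux
  have step : ∃ ε₀ : ℝ, 0 < ε₀ ∧ ∀ (m : ℕ)
      (A : HierTensor.TensorSpace n →ₗ[ℝ] EuclideanSpace ℝ (Fin m)),
      HierTensor.tric S (fun α => 3 * r α) A < δ' →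
      ∀ v ∈ HierTensor.rankEq n S r, ‖v - u‖ ≤ ε₀ →
      (v, HierTensor.rgiDirection (HierTensor.rankEq n S r) A (A u) v) ∈ D ∧
        ‖R (v, HierTensor.rgiDirection (HierTensor.rankEq n S r) A (A u) v) - u‖ ≤
          ρ * ‖v - u‖ := by
    by_cases hr : ∀ α ∈ S, 1 ≤ r α
    · exact HierTensor.exists_step_contraction hS hr hR hueq hδ'0 hδ'1 hδρ
    -- A prescribed rank zero forces every tensor of the format to vanish. This case is separate
    -- because unit tensors then violate the rank bound and give no control of `A`.
    · push Not at hr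
      obtain ⟨α, hα, hrα⟩ := hr
      have hr0 : r α = 0 := by omega
      have hz : ∀ v ∈ HierTensor.rankEq n S r, v = 0 := fun v hv =>
        HierTensor.eq_zero_of_rank_matricisation_eq_zero ((hv α hα).trans hr0)
      refine ⟨1, one_pos, fun m A _ v hv _ => ?_⟩
      obtain rfl := hz v hv
      obtain rfl := hz u hueq
      have hdir : HierTensor.rgiDirection (HierTensor.rankEq n S r) A (A 0) 0 = 0 := by
        simp [HierTensor.rgiDirection]
      rw [hdir, hR.map_zero 0 hv]
      exact ⟨mem_of_mem_nhdsWithin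
        (show (0, 0) ∈ HierTensor.tangentPairs _ from ⟨hv, zero_mem _⟩) (hR.nhds_zero 0 hv), by simp⟩
  obtain ⟨ε₀, hε₀, hstep⟩ := step
  refine ⟨ε₀, hε₀, fun ε _ hεε m A hA x hx0 hux _ hx => ?_⟩
  have hstepA := hstep m A (hA.trans_lt hδδ')
  have hall : ∀ k, x k ∈ HierTensor.rankEq n S r ∧ ‖x k - u‖ ≤ ρ ^ k * ‖x 0 - u‖ ∧
      ‖x k - u‖ ≤ ε₀ := by
    intro k
    induction k with
    | zero =>
      refine ⟨hx0, by simp, ?_⟩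
      rw [norm_sub_rev]
      exact hux.trans hεε
    | succ k ih =>
      obtain ⟨h1, h2, h3⟩ := ih
      obtain ⟨h4, h5⟩ := hstepA (x k) h1 h3
      rw [← hx k] at h5
      refine ⟨?_, ?_, ?_⟩
      · rw [hx k]
        exact hR.mapsTo _ h4
      · calc _ ≤ ρ * ‖x k - u‖ := h5
          _ ≤ ρ * (ρ ^ k * ‖x 0 - u‖) := by gcongr
          _ = ρ ^ (k + 1) * ‖x 0 - u‖ := by ring
      · exact h5.trans ((mul_le_of_le_one_left (norm_nonneg _) hρ1.le).trans h3)
  refine ⟨fun k => ⟨(hall k).1, (hstepA _ (hall k).1 (hall k).2.2).1⟩, fun k => ?_, ?_⟩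
  · rw [hx k]
    exact (hstepA _ (hall k).1 (hall k).2.2).2
  · rw [tendsto_iff_norm_sub_tendsto_zero]
    refine squeeze_zero (fun _ => norm_nonneg _) (fun k => (hall k).2.1) ?_
    simpa using (tendsto_pow_atTop_nhds_zero_of_lt_one hρ0.le hρ1).mul_const ‖x 0 - u‖
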